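/- Let $d\ge 1$, let $\lambda_1,\dots,\lambda_d\in\mathbb C$ be roots of some polynomial of degree $d$ with integer coefficients that is irreducible over $\mathbb Q$ (for instance all of its roots), and let $c_1,\dots,c_d\in\mathbb C$. Assume the dominant root condition: $\lambda_1$ is real, $\lambda_1>1$, $\lambda_1>|\lambda_j|$ for all $j\in\{2,\dots,d\}$, and $c_1\neq 0$. Let $(a_k)_{k\ge1}$ be a sequence of positive integers such that $$a_k=c_1\lambda_1^k+\dots+c_d\lambda_d^k\qquad\text{for all } k\ge 1.$$ For $n\ge1$ let $S_n(\omega)=\sum_{k=1}^n\cos(2\pi a_k\omega)$, regarded as a random variable on $[0,1]$ with Lebesgue measure, and for $m\ge1$ let $$\kappa_m(S_n)=\frac{d^m}{dt^m}\log\left(\int_0^1 e^{tS_n(\omega)}\,d\omega\right)\Big|_{t=0}$$ be its $m$-th cumulant. Then for every integer $m\ge1$ there are integers $w_m,b_m$, depending only on $m$ and $c_1,\dots,c_d,\lambda_1,\dots,\lambda_d$, and an integer $n_1(m)$, such that $$\kappa_m(S_n)=2^{-m}(w_m n+b_m)\qquad\text{for all } n>n_1(m).$$ -/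

import Mathlib

open MeasureTheory ProbabilityTheory

/-- The `m`-th cumulant of a real random variable `X`: the `m`-th derivative at `0` of the
logarithm of its moment generating function `t ↦ 𝔼[exp (t X)]`. -/
noncomputable def cumulant {Ω : Type*} [MeasurableSpace Ω] (m : ℕ) (X : Ω → ℝ)
    (μ : Measure Ω) : ℝ :=
  iteratedDeriv m (cgf X μ) 0

/-- The uniform distribution (Lebesgue measure) on `[0, 1]`. -/
noncomputable def uniform01 : Measure ℝ :=
  (volume : Measure ℝ).restrict (Set.Icc 0 1)

/-- The trigonometric sum `S_n(ω) = ∑_{k=1}^n cos (2 π a_k ω)`. -/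
noncomputable def trigSum (a : ℕ → ℕ) (n : ℕ) (ω : ℝ) : ℝ :=
  ∑ k ∈ Finset.Icc 1 n, Real.cos (2 * Real.pi * (a k : ℝ) * ω)

/-- The numbers `lam 0, …, lam (d-1)` (in the usual notation `λ₁, …, λ_d`) are roots of a
polynomial of degree `d` with integer coefficients that is irreducible over `ℚ`. -/
def AreRootsOfIrreducible {d : ℕ} (lam : Fin d → ℂ) : Prop :=
  ∃ P : Polynomial ℤ, P.natDegree = d ∧ Irreducible (P.map (Int.castRingHom ℚ)) ∧
    ∀ j, Polynomial.aeval (lam j) P = 0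

/-- The dominant root condition: `λ₁` is real, `λ₁ > 1`, `λ₁ > |λ_j|` for `j ≥ 2`, and
`c₁ ≠ 0` (the first index is `0 : Fin d`). -/
def DominantRoot {d : ℕ} (hd : 0 < d) (c lam : Fin d → ℂ) : Prop :=
  (lam ⟨0, hd⟩).im = 0 ∧ 1 < (lam ⟨0, hd⟩).re ∧
    (∀ j, j ≠ ⟨0, hd⟩ → ‖lam j‖ < (lam ⟨0, hd⟩).re) ∧ c ⟨0, hd⟩ ≠ 0

/-! Write `2 * trigSum a n` as a sum of `2 * n` exponentials with frequencies `± a k`, for `1 ≤ k ≤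
n`. By multilinearity `2 ^ m * cumulant m` is the sum, over all `m`-tuples of these exponentials, of
their joint cumulants. By orthogonality the joint moment of a subset of a tuple is `1` if its signed
frequencies add up to `0`, and `0` otherwise. The recursion from moments to cumulants therefore
stays in `ℤ`, which explains the factor `2 ^ (-m)` and the integrality.

Linearity in `n` comes from two properties of the joint cumulants. They vanish unless the indices of
the tuple lie within a bounded distance `D`: a short signed sum with indices at least `T` is zero or
at least `δ * lam ^ T` (`exists_lower_bound`), so terms far below `T` cannot cancel it. Across a
large gap the moments factor, as for independent groups, and `jointCumulant_eq_zero` applies. They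
are also eventually invariant under translation of the indices (`eventually_jointCumulant_eq`),
because for large indices a signed sum of fixed shape vanishes exactly when the corresponding
relation between powers of `lam` holds. Irreducibility gives one direction by passing to the
conjugates, the dominant root gives the other.

Hence passing from `n` to `n + 1` adds the tuples with largest index `n + 1`; up to translation,
finitely many of them contribute, so the increment is eventually a constant integer. -/

/-! ### Joint cumulants of finite families -/

/-- The joint cumulants attached to a family of joint moments `μ` indexed by finite sets, defined
by `μ B = ∑ κ C * μ (B \ C)`, the sum being over the `C ⊆ B` which contain the least element
of `B`. -/
def jointCumulant {ι : Type*} [LinearOrder ι] (μ : Finset ι → ℤ) (B : Finset ι) : ℤ :=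
  if h : B.Nonempty then
    μ B - ∑ C ∈ (B.erase (B.min' h)).ssubsets.attach,
      jointCumulant μ (insert (B.min' h) C.1) * μ ((B.erase (B.min' h)) \ C.1)
  else 0
termination_by B.card
decreasing_by
  have hC := Finset.mem_ssubsets.1 C.2
  have h1 := Finset.card_lt_card hC
  have h2 := Finset.card_insert_le (B.min' h) C.1
  have h3 := Finset.card_erase_of_mem (B.min'_mem h)
  omega

/-- The term with `C` all of `B.erase b` is the cumulant of `B` times `μ ∅ = 1`, so the defining
recursion moves to one side. -/
theorem sum_jointCumulant {ι : Type*} [LinearOrder ι] {μ : Finset ι → ℤ} (hμ : μ ∅ = 1)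
    {B : Finset ι} (h : B.Nonempty) :
    ∑ C ∈ (B.erase (B.min' h)).powerset,
      jointCumulant μ (insert (B.min' h) C) * μ ((B.erase (B.min' h)) \ C) = μ B := by
  have h1 : jointCumulant μ B = μ B - ∑ C ∈ (B.erase (B.min' h)).ssubsets,
      jointCumulant μ (insert (B.min' h) C) * μ ((B.erase (B.min' h)) \ C) := by
    rw [jointCumulant, dif_pos h, ← Finset.sum_attach (B.erase (B.min' h)).ssubsets]
  have h2 : (B.erase (B.min' h)).ssubsets
      = (B.erase (B.min' h)).powerset.erase (B.erase (B.min' h)) := rfl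
  rw [← Finset.add_sum_erase _ _ (Finset.mem_powerset_self (B.erase (B.min' h))), ← h2,
    Finset.insert_erase (B.min'_mem h), sdiff_self, Finset.bot_eq_empty, hμ, h1]
  ring

theorem jointCumulant_eq_zero_aux {ι : Type*} [LinearOrder ι] {μ : Finset ι → ℤ} (hμ : μ ∅ = 1)
    (p : ι → Prop) [DecidablePred p] (hp : ∀ B, μ B = μ (B.filter p) * μ (B.filter (¬ p ·)))
    {B : Finset ι} (h : B.Nonempty)
    (IH : ∀ C ⊂ B, (∃ i ∈ C, p i) → (∃ i ∈ C, ¬ p i) → jointCumulant μ C = 0)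
    (hmin : p (B.min' h)) (hB : ∃ i ∈ B, ¬ p i) : jointCumulant μ B = 0 := by
  set b := B.min' h with hb
  have hbB : b ∈ B := B.min'_mem h
  have h' : (B.filter p).Nonempty := ⟨b, Finset.mem_filter.2 ⟨hbB, hmin⟩⟩
  have hb' : (B.filter p).min' h' = b := by
    apply le_antisymm
    · exact Finset.min'_le _ _ (Finset.mem_filter.2 ⟨hbB, hmin⟩)
    · exact Finset.min'_le _ _ (Finset.mem_filter.1 (Finset.min'_mem _ h')).1
  have e1 := sum_jointCumulant hμ h
  have e2 := sum_jointCumulant hμ h'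
  rw [hb'] at e2
  rw [← hb] at e1
  have hnot : B.erase b ∉ ((B.filter p).erase b).powerset := by
    intro hmem
    obtain ⟨i, hi, hpi⟩ := hB
    have hib : i ≠ b := fun e => hpi (e ▸ hmin)
    have := Finset.mem_powerset.1 hmem (Finset.mem_erase.2 ⟨hib, hi⟩)
    exact hpi (Finset.mem_filter.1 (Finset.mem_erase.1 this).2).2
  have hsub : insert (B.erase b) ((B.filter p).erase b).powerset ⊆ (B.erase b).powerset := by
    intro C hC
    rcases Finset.mem_insert.1 hC with rfl | hC
    · exact Finset.mem_powerset_self _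
    · exact Finset.mem_powerset.2 ((Finset.mem_powerset.1 hC).trans
        (Finset.erase_subset_erase _ (Finset.filter_subset _ _)))
  -- In the recursion for `B`, every `insert b C` that is a proper subset meeting both classes drops
  -- out by `IH`. What survives is the term of `B` itself and the `C` inside the class of `b`.
  rw [← Finset.sum_subset hsub, Finset.sum_insert hnot, Finset.insert_erase hbB, sdiff_self,
    Finset.bot_eq_empty, hμ, mul_one] at e1
  -- The surviving `C` inside the class of `b` already give all of `μ B`: the moment of the other
  -- class factors out and the recursion for `B.filter p` remains. So the cumulant of `B` is zero.
  · have e3 : ∑ C ∈ ((B.filter p).erase b).powerset,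
        jointCumulant μ (insert b C) * μ (B.erase b \ C) = μ B := by
      rw [hp B, ← e2, Finset.sum_mul]
      refine Finset.sum_congr rfl fun C hC => ?_
      have hCs := Finset.mem_powerset.1 hC
      have hCp : ∀ i ∈ C, p i := fun i hi =>
        (Finset.mem_filter.1 (Finset.mem_erase.1 (hCs hi)).2).2
      have e3 : (B.erase b \ C).filter p = (B.filter p).erase b \ C := by
        ext i
        simp only [Finset.mem_filter, Finset.mem_sdiff, Finset.mem_erase]
        tauto
      have e4 : (B.erase b \ C).filter (¬ p ·) = B.filter (¬ p ·) := by
        ext i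
        simp only [Finset.mem_filter, Finset.mem_sdiff, Finset.mem_erase]
        constructor
        · tauto
        · rintro ⟨hi, hpi⟩
          exact ⟨⟨⟨fun e => hpi (e ▸ hmin), hi⟩, fun hC => hpi (hCp i hC)⟩, hpi⟩
      rw [hp (B.erase b \ C), e3, e4, mul_assoc]
    omega
  · intro C hC hC'
    rw [Finset.mem_insert, not_or] at hC'
    have hCs := Finset.mem_powerset.1 hC
    rw [IH, zero_mul]
    · rw [Finset.ssubset_iff_subset_ne]
      refine ⟨Finset.insert_subset hbB (hCs.trans (Finset.erase_subset _ _)), fun e => hC'.1 ?_⟩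
      rw [← e, Finset.erase_insert]
      exact fun hbC => (Finset.mem_erase.1 (hCs hbC)).1 rfl
    · exact ⟨b, Finset.mem_insert_self _ _, hmin⟩
    · by_contra hcon
      push Not at hcon
      refine hC'.2 (Finset.mem_powerset.2 fun i hi => ?_)
      have := Finset.mem_erase.1 (hCs hi)
      exact Finset.mem_erase.2 ⟨this.1,
        Finset.mem_filter.2 ⟨this.2, hcon i (Finset.mem_insert_of_mem hi)⟩⟩

/-- Joint cumulants of two independent groups of variables vanish. -/
theorem jointCumulant_eq_zero {ι : Type*} [LinearOrder ι] {μ : Finset ι → ℤ} (hμ : μ ∅ = 1)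
    (p : ι → Prop) [DecidablePred p] (hp : ∀ B, μ B = μ (B.filter p) * μ (B.filter (¬ p ·)))
    (B : Finset ι) (h1 : ∃ i ∈ B, p i) (h2 : ∃ i ∈ B, ¬ p i) : jointCumulant μ B = 0 := by
  induction B using Finset.strongInduction with
  | H B IH =>
    have h : B.Nonempty := h1.imp fun _ hi => hi.1
    by_cases hmin : p (B.min' h)
    · exact jointCumulant_eq_zero_aux hμ p hp h IH hmin h2
    · refine jointCumulant_eq_zero_aux hμ (fun i => ¬ p i) ?_ h
        (fun C hC a b => IH C hC (by simpa using b) a) hmin (by simpa using h1)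
      intro C
      simpa [mul_comm] using hp C

/-- Joint cumulants of `B` only depend on the moments of the subsets of `B`. -/
theorem jointCumulant_congr {ι : Type*} [LinearOrder ι] {μ ν : Finset ι → ℤ} (B : Finset ι)
    (h : ∀ C ⊆ B, μ C = ν C) : jointCumulant μ B = jointCumulant ν B := by
  induction B using Finset.strongInduction with
  | H B IH =>
    rw [jointCumulant, jointCumulant]
    split_ifs with hB
    · rw [h B subset_rfl]
      congr 1
      refine Finset.sum_congr rfl fun C _ => ?_
      have hC := Finset.mem_ssubsets.1 C.2
      have hs : insert (B.min' hB) C.1 ⊆ B := Finset.insert_subset (B.min'_mem hB)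
        (hC.1.trans (Finset.erase_subset _ _))
      rw [IH _ _ fun D hD => h D (hD.trans hs),
        h _ (Finset.sdiff_subset.trans (Finset.erase_subset _ _))]
      rw [Finset.ssubset_iff_subset_ne]
      refine ⟨hs, fun e => hC.2 ?_⟩
      refine (Finset.erase_subset_erase _ e.ge).trans (Finset.erase_insert_subset _ _)
    · rfl

/-! ### Averaging the moment–cumulant recursion over tuples -/

/-- Sums over tuples of functions of disjoint sets of coordinates factor. -/
theorem sum_piFinset_mul_of_disjoint {ι X : Type*} [Fintype ι] [DecidableEq ι] (S : Finset X)
    (C : Finset ι) (f g : (ι → X) → ℝ)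
    (hf : ∀ v w, (∀ i ∈ C, v i = w i) → f v = f w)
    (hg : ∀ v w, (∀ i ∉ C, v i = w i) → g v = g w) :
    (∑ v ∈ Fintype.piFinset fun _ : ι => S, f v) * (∑ v ∈ Fintype.piFinset fun _ : ι => S, g v)
      = (S.card : ℝ) ^ Fintype.card ι * ∑ v ∈ Fintype.piFinset fun _ : ι => S, f v * g v := by
  have key : ∑ x ∈ (Fintype.piFinset fun _ : ι => S) ×ˢ (Fintype.piFinset fun _ : ι => S),
      f x.1 * g x.2
      = ∑ x ∈ (Fintype.piFinset fun _ : ι => S) ×ˢ (Fintype.piFinset fun _ : ι => S),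
      f x.1 * g x.1 := by
    -- The involution exchanges the coordinates outside `C` between the two tuples.
    refine Finset.sum_nbij' (fun x => (C.piecewise x.1 x.2, C.piecewise x.2 x.1))
      (fun x => (C.piecewise x.1 x.2, C.piecewise x.2 x.1)) ?_ ?_ ?_ ?_ ?_
    · intro x hx
      simp only [Finset.mem_product, Fintype.mem_piFinset] at hx ⊢
      constructor <;> intro i <;> by_cases hi : i ∈ C <;> simp [hi, hx.1 i, hx.2 i]
    · intro x hx
      simp only [Finset.mem_product, Fintype.mem_piFinset] at hx ⊢
      constructor <;> intro i <;> by_cases hi : i ∈ C <;> simp [hi, hx.1 i, hx.2 i]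
    · intro x _
      ext i <;> by_cases hi : i ∈ C <;> simp [hi]
    · intro x _
      ext i <;> by_cases hi : i ∈ C <;> simp [hi]
    · intro x _
      rw [hf x.1 (C.piecewise x.1 x.2) fun i hi => by simp [hi],
        hg x.2 (C.piecewise x.1 x.2) fun i hi => by simp [hi]]
  rw [Finset.sum_mul_sum, ← Finset.sum_product', key, Finset.sum_product]
  simp only [Finset.sum_const, nsmul_eq_mul, Fintype.card_piFinset, Finset.prod_const,
    Finset.mul_sum, Finset.card_univ, Nat.cast_pow]

/-- If the averaged joint moments are `r ^ |B| * M |B|`, then the averaged joint cumulants are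
`r ^ |B| * K |B|`, where `K` are the cumulants attached to the moments `M`. -/
theorem averaged_cumulant {ι : Type*} [LinearOrder ι] {M K : ℕ → ℝ} (hM0 : M 0 = 1) (r : ℝ)
    (hMK : ∀ p, M (p + 1) = ∑ i ∈ Finset.range (p + 1), p.choose i • (K (i + 1) * M (p - i)))
    {μ κ : Finset ι → ℝ} (hμ : ∀ B, μ B = r ^ B.card * M B.card)
    (hκ : ∀ (B : Finset ι) (h : B.Nonempty), ∑ C ∈ (B.erase (B.min' h)).powerset,
      κ (insert (B.min' h) C) * μ ((B.erase (B.min' h)) \ C) = μ B)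
    (B : Finset ι) (h : B.Nonempty) : κ B = r ^ B.card * K B.card := by
  induction B using Finset.strongInduction with
  | H B IH =>
    have e1 := hκ B h
    set b := B.min' h
    have hbB : b ∈ B := B.min'_mem h
    have hcard : (B.erase b).card + 1 = B.card := Finset.card_erase_add_one hbB
    have e2 : ∑ C ∈ (B.erase b).powerset,
        r ^ B.card * (K (C.card + 1) * M ((B.erase b).card - C.card)) = μ B := by
      rw [← Finset.mul_sum, Finset.sum_powerset_apply_card
        (fun i => K (i + 1) * M ((B.erase b).card - i)), ← hMK, hμ, hcard]
    rw [← e2, ← Finset.add_sum_erase _ _ (Finset.mem_powerset_self (B.erase b)),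
      ← Finset.add_sum_erase _ _ (Finset.mem_powerset_self (B.erase b))] at e1
    rw [Finset.sum_congr rfl (g := fun C =>
      r ^ B.card * (K (C.card + 1) * M ((B.erase b).card - C.card)))] at e1
    · rw [Finset.insert_erase hbB, sdiff_self, Finset.bot_eq_empty, hμ, hcard] at e1
      simp only [Finset.card_empty, pow_zero, Nat.sub_self, hM0, mul_one] at e1
      linarith
    · intro C hC
      obtain ⟨hne, hC⟩ := Finset.mem_erase.1 hC
      have hCs := Finset.mem_powerset.1 hC
      have hbC : b ∉ C := fun hbC => (Finset.mem_erase.1 (hCs hbC)).1 rfl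
      have hle := Finset.card_le_card hCs
      rw [IH (insert b C) _ (Finset.insert_nonempty _ _), hμ, Finset.card_sdiff_of_subset hCs,
        Finset.card_insert_of_notMem hbC]
      · have : B.card = (C.card + 1) + ((B.erase b).card - C.card) := by omega
        rw [this, pow_add]
        ring
      · rw [Finset.ssubset_iff_subset_ne]
        refine ⟨Finset.insert_subset hbB (hCs.trans (Finset.erase_subset _ _)), fun e => hne ?_⟩
        rw [← e, Finset.erase_insert hbC]

/-! ### Signed sums of a sequence with dominant growth -/

open Filter Topology in
/-- A sequence `a` with `a n ∼ c * lam ^ n`, `lam > 1`, such that each integral linear relation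
between powers of `lam` is also satisfied by the shifts of `a`. -/
structure DominantGrowth (a : ℕ → ℕ) (lam c : ℝ) : Prop where
  one_lt : 1 < lam
  ne_zero : c ≠ 0
  tendsto : Tendsto (fun n => (a n : ℝ) / lam ^ n) atTop (𝓝 c)
  relation : ∀ {m : ℕ} (B : Finset (Fin m)) (s : Fin m → ℤ) (e : Fin m → ℕ),
    ∑ i ∈ B, (s i : ℝ) * lam ^ e i = 0 → ∀ n, 1 ≤ n → ∑ i ∈ B, s i * (a (n + e i) : ℤ) = 0

namespace DominantGrowth

open Filter Topology

variable {a : ℕ → ℕ} {lam c : ℝ}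

theorem pos (h : DominantGrowth a lam c) : 0 < lam := one_pos.trans h.one_lt

theorem tendsto_sum (h : DominantGrowth a lam c) {m : ℕ} (B : Finset (Fin m)) (s : Fin m → ℤ)
    (e : Fin m → ℕ) :
    Tendsto (fun n => ((∑ i ∈ B, s i * (a (n + e i) : ℤ) : ℤ) : ℝ) / lam ^ n) atTop
      (𝓝 (c * ∑ i ∈ B, (s i : ℝ) * lam ^ e i)) := by
  rw [Finset.mul_sum]
  have : (fun n => ((∑ i ∈ B, s i * (a (n + e i) : ℤ) : ℤ) : ℝ) / lam ^ n)
      = fun n => ∑ i ∈ B, (a (n + e i) : ℝ) / lam ^ (n + e i) * (s i * lam ^ e i) := by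
    ext n
    push_cast
    rw [Finset.sum_div]
    refine Finset.sum_congr rfl fun i _ => ?_
    have := h.pos.ne'
    rw [pow_add]
    field_simp
  rw [this]
  refine tendsto_finsetSum _ fun i _ => ?_
  exact (h.tendsto.comp (tendsto_add_atTop_nat (e i))).mul_const _

theorem eventually_sum_eq_zero_iff (h : DominantGrowth a lam c) {m : ℕ} (B : Finset (Fin m))
    (s : Fin m → ℤ) (e : Fin m → ℕ) :
    ∀ᶠ n in atTop, ∑ i ∈ B, s i * (a (n + e i) : ℤ) = 0 ↔
      ∑ i ∈ B, (s i : ℝ) * lam ^ e i = 0 := by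
  by_cases h0 : ∑ i ∈ B, (s i : ℝ) * lam ^ e i = 0
  · filter_upwards [eventually_ge_atTop 1] with n hn
    simp [h0, h.relation B s e h0 n hn]
  · filter_upwards [(h.tendsto_sum B s e).eventually_ne (mul_ne_zero h.ne_zero h0)] with n hn
    simp only [h0, iff_false]
    intro h1
    simp [h1] at hn

theorem exists_le (h : DominantGrowth a lam c) : ∃ C > 0, ∀ n, (a n : ℝ) ≤ C * lam ^ n := by
  obtain ⟨C, hC⟩ := h.tendsto.bddAbove_range
  refine ⟨max C 1, by positivity, fun n => ?_⟩
  rw [← div_le_iff₀ (pow_pos h.pos n)]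
  exact (hC ⟨n, rfl⟩).trans (le_max_left _ _)

/-- A linear form of fixed shape in the shifts of `a` is zero or large. -/
theorem eventually_lower_bound_of_shape (h : DominantGrowth a lam c) {m : ℕ} (B : Finset (Fin m))
    (s : Fin m → ℤ) (e : Fin m → ℕ) :
    ∀ᶠ δ in 𝓝[>] (0 : ℝ), ∀ n, 1 ≤ n → ∑ i ∈ B, s i * (a (n + e i) : ℤ) = 0 ∨
      δ * lam ^ n ≤ |((∑ i ∈ B, s i * (a (n + e i) : ℤ) : ℤ) : ℝ)| := by
  by_cases h0 : ∑ i ∈ B, (s i : ℝ) * lam ^ e i = 0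
  · filter_upwards with δ n hn using Or.inl (h.relation B s e h0 n hn)
  · have h1 := (h.tendsto_sum B s e).abs
    have hL : 0 < |c * ∑ i ∈ B, (s i : ℝ) * lam ^ e i| := abs_pos.2 (mul_ne_zero h.ne_zero h0)
    obtain ⟨N, hN⟩ := eventually_atTop.1 (h1.eventually_const_le (half_lt_self hL))
    -- Half the limit serves for `n ≥ N`. For `n ≤ N` a nonzero integer is at least `1`, which `δ ≤
    -- lam ^ (-N)` suffices to use.
    have hpos : 0 < min (|c * ∑ i ∈ B, (s i : ℝ) * lam ^ e i| / 2) (lam ^ N)⁻¹ :=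
      lt_min (half_pos hL) (inv_pos.2 (pow_pos h.pos N))
    filter_upwards [Ioo_mem_nhdsGT hpos] with δ hδ n hn
    obtain ⟨hδ0, hδ⟩ := hδ
    by_cases hz : ∑ i ∈ B, s i * (a (n + e i) : ℤ) = 0
    · exact Or.inl hz
    · right
      rcases le_total N n with hNn | hNn
      · have := hN n hNn
        rw [abs_div, abs_of_pos (pow_pos h.pos n), le_div_iff₀ (pow_pos h.pos n)] at this
        exact (mul_le_mul_of_nonneg_right (hδ.le.trans (min_le_left _ _))
          (pow_pos h.pos n).le).trans this
      · have h2 : (1 : ℝ) ≤ |((∑ i ∈ B, s i * (a (n + e i) : ℤ) : ℤ) : ℝ)| := by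
          rw [← Int.cast_abs]
          exact_mod_cast Int.one_le_abs hz
        refine le_trans ?_ h2
        calc δ * lam ^ n ≤ (lam ^ N)⁻¹ * lam ^ N :=
              mul_le_mul (hδ.le.trans (min_le_right _ _)) (pow_le_pow_right₀ h.one_lt.le hNn)
                (pow_pos h.pos n).le (inv_pos.2 (pow_pos h.pos N)).le
          _ = 1 := inv_mul_cancel₀ (pow_pos h.pos N).ne'

end DominantGrowth

/-- A finite family of natural numbers either has bounded diameter or has a gap. -/
theorem diam_le_or_exists_gap {ι : Type*} (B : Finset ι) (k : ι → ℕ) (G : ℕ)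
    (hG : 0 < G) {j : ι} (hj : j ∈ B) (hmin : ∀ i ∈ B, k j ≤ k i) :
    (∀ i ∈ B, k i ≤ k j + B.card * G) ∨
      ∃ T, (∀ i ∈ B, T ≤ k i ∨ k i + G ≤ T) ∧ (∃ i ∈ B, T ≤ k i) ∧ k j + G ≤ T := by
  classical
  by_cases hd : ∀ i ∈ B, k i ≤ k j + B.card * G
  · exact Or.inl hd
  right
  push Not at hd
  obtain ⟨l, hl, hlk⟩ := hd
  -- Pigeonhole: cut the range above `k j` into `B.card` blocks of length `G`. The fewer than
  -- `B.card` other elements leave some block `r` empty, and `T` is the first integer after it.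
  have hcard : ((B.erase j).image fun i => (k i - k j - 1) / G).card
      < (Finset.range B.card).card := by
    refine Finset.card_image_le.trans_lt ?_
    rw [Finset.card_range]
    exact Finset.card_erase_lt_of_mem hj
  obtain ⟨r, hr, hr'⟩ := Finset.exists_mem_notMem_of_card_lt_card hcard
  rw [Finset.mem_range] at hr
  have hrG : (r + 1) * G ≤ B.card * G := Nat.mul_le_mul_right _ hr
  refine ⟨k j + 1 + (r + 1) * G, fun i hi => ?_, ⟨l, hl, by omega⟩, ?_⟩
  · by_cases hij : i = j
    · right
      subst hij
      rw [add_mul]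
      omega
    · have hne : (k i - k j - 1) / G ≠ r := fun h =>
        hr' (Finset.mem_image.2 ⟨i, Finset.mem_erase.2 ⟨hij, hi⟩, h⟩)
      have := hmin i hi
      rcases lt_or_gt_of_ne hne with h | h
      · right
        rw [Nat.div_lt_iff_lt_mul hG] at h
        rw [add_mul]
        omega
      · left
        have h2 := (Nat.le_div_iff_mul_le hG).1 h
        rw [Nat.succ_eq_add_one] at h2
        have : 0 < (r + 1) * G := by positivity
        omega
  · rw [add_mul]
    omega

namespace DominantGrowth

open Filter Topology

variable {a : ℕ → ℕ} {lam c : ℝ}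

/-- Linear forms whose indices lie in a window of bounded size are zero or large. -/
theorem exists_lower_bound_of_diam_le (h : DominantGrowth a lam c) (m D : ℕ) :
    ∃ δ : ℝ, 0 < δ ∧ ∀ (B : Finset (Fin m)) (s : Fin m → ℤˣ) (k : Fin m → ℕ) (n : ℕ), 1 ≤ n →
      (∀ i ∈ B, n ≤ k i ∧ k i ≤ n + D) → ∑ i ∈ B, (s i : ℤ) * (a (k i) : ℤ) = 0 ∨
      δ * lam ^ n ≤ |((∑ i ∈ B, (s i : ℤ) * (a (k i) : ℤ) : ℤ) : ℝ)| := by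
  -- A window of size `D` allows finitely many shapes, and each admits all small `δ`, so one `δ`
  -- serves them all.
  have key : ∀ᶠ δ in 𝓝[>] (0 : ℝ), ∀ (x : Finset (Fin m) × (Fin m → ℤˣ) × (Fin m → Fin (D + 1))),
      ∀ n, 1 ≤ n → ∑ i ∈ x.1, (x.2.1 i : ℤ) * (a (n + x.2.2 i) : ℤ) = 0 ∨
      δ * lam ^ n ≤ |((∑ i ∈ x.1, (x.2.1 i : ℤ) * (a (n + x.2.2 i) : ℤ) : ℤ) : ℝ)| :=
    eventually_all.2 fun x => h.eventually_lower_bound_of_shape x.1 (fun i => x.2.1 i)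
      fun i => x.2.2 i
  obtain ⟨δ, hδ, hδ0⟩ := (key.and self_mem_nhdsWithin).exists
  refine ⟨δ, hδ0, fun B s k n hn hk => ?_⟩
  have := hδ (B, s, fun i => Fin.ofNat (D + 1) (k i - n)) n hn
  have e : ∑ i ∈ B, (s i : ℤ) * (a (n + (Fin.ofNat (D + 1) (k i - n) : Fin (D + 1))) : ℤ)
      = ∑ i ∈ B, (s i : ℤ) * (a (k i) : ℤ) := by
    refine Finset.sum_congr rfl fun i hi => ?_
    obtain ⟨h1, h2⟩ := hk i hi
    rw [Fin.val_ofNat, Nat.mod_eq_of_lt (by omega), Nat.add_sub_cancel' h1]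
  simpa only [e] using this

theorem abs_sum_le {C : ℝ} (hC0 : 0 < C) (h : DominantGrowth a lam c)
    (hC : ∀ n, (a n : ℝ) ≤ C * lam ^ n) {m : ℕ}
    (B : Finset (Fin m)) (s : Fin m → ℤˣ) (k : Fin m → ℕ) (n : ℕ) (hk : ∀ i ∈ B, k i ≤ n) :
    |((∑ i ∈ B, (s i : ℤ) * (a (k i) : ℤ) : ℤ) : ℝ)| ≤ m * (C * lam ^ n) := by
  push_cast
  refine (Finset.abs_sum_le_sum_abs _ _).trans ?_
  calc ∑ i ∈ B, |((s i : ℤ) : ℝ) * (a (k i) : ℝ)| ≤ ∑ i ∈ B, C * lam ^ n := by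
        refine Finset.sum_le_sum fun i hi => ?_
        have : |((s i : ℤ) : ℝ)| = 1 := by
          rcases Int.units_eq_one_or (s i) with h | h <;> simp [h]
        rw [abs_mul, this, one_mul, abs_of_nonneg (Nat.cast_nonneg _)]
        exact (hC _).trans (mul_le_mul_of_nonneg_left
          (pow_le_pow_right₀ h.one_lt.le (hk i hi)) hC0.le)
    _ = B.card * (C * lam ^ n) := by simp
    _ ≤ m * (C * lam ^ n) := by
        have := pow_pos h.pos n
        have h2 : B.card ≤ m := by simpa using Finset.card_le_univ B
        gcongr

theorem exists_gap_size (h : DominantGrowth a lam c) {δ : ℝ} (hδ : 0 < δ) (M : ℝ) :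
    ∃ G : ℕ, 0 < G ∧ ∀ n T : ℕ, n + G ≤ T → M * lam ^ n < δ * lam ^ T := by
  obtain ⟨G, hG⟩ := ((tendsto_pow_atTop_atTop_of_one_lt h.one_lt).eventually_gt_atTop
    (M / δ)).exists
  refine ⟨G + 1, by omega, fun n T hT => ?_⟩
  rw [div_lt_iff₀ hδ] at hG
  calc M * lam ^ n < lam ^ G * δ * lam ^ n := mul_lt_mul_of_pos_right hG (pow_pos h.pos n)
    _ = δ * lam ^ (G + n) := by ring
    _ ≤ δ * lam ^ T := mul_le_mul_of_nonneg_left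
        (pow_le_pow_right₀ h.one_lt.le (by omega)) hδ.le

/-- Signed sums of `m` terms with indices at least `n` are zero or at least `δ * lam ^ n`. -/
theorem exists_lower_bound (h : DominantGrowth a lam c) (m : ℕ) :
    ∃ δ : ℝ, 0 < δ ∧ ∀ (B : Finset (Fin m)) (s : Fin m → ℤˣ) (k : Fin m → ℕ) (n : ℕ), 1 ≤ n →
      (∀ i ∈ B, n ≤ k i) → ∑ i ∈ B, (s i : ℤ) * (a (k i) : ℤ) = 0 ∨
      δ * lam ^ n ≤ |((∑ i ∈ B, (s i : ℤ) * (a (k i) : ℤ) : ℤ) : ℝ)| := by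
  obtain ⟨C, hC0, hC⟩ := h.exists_le
  suffices H : ∀ p : ℕ, ∃ δ : ℝ, 0 < δ ∧ ∀ (B : Finset (Fin m)) (s : Fin m → ℤˣ)
      (k : Fin m → ℕ) (n : ℕ), B.card ≤ p → 1 ≤ n →
      (∀ i ∈ B, n ≤ k i) → ∑ i ∈ B, (s i : ℤ) * (a (k i) : ℤ) = 0 ∨
      δ * lam ^ n ≤ |((∑ i ∈ B, (s i : ℤ) * (a (k i) : ℤ) : ℤ) : ℝ)| by
    obtain ⟨δ, hδ, H⟩ := H m
    exact ⟨δ, hδ, fun B s k n => H B s k n (by simpa using Finset.card_le_univ B)⟩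
  intro p
  induction p with
  | zero =>
    refine ⟨1, one_pos, fun B s k n hB _ _ => Or.inl ?_⟩
    rw [Finset.card_eq_zero.1 (Nat.le_zero.1 hB), Finset.sum_empty]
  | succ p ih =>
    obtain ⟨δ, hδ, ih⟩ := ih
    -- With this `G` the terms below a gap add up to less than half of the inductive lower bound for
    -- a nonzero sum above it. Without a gap the indices lie in a window of size `m * G`.
    obtain ⟨G, hG0, hG⟩ := h.exists_gap_size (half_pos hδ) (m * C)
    obtain ⟨ε, hε, hw⟩ := h.exists_lower_bound_of_diam_le m (m * G)
    refine ⟨min (δ / 2) ε, lt_min (half_pos hδ) hε, fun B s k n hB hn hk => ?_⟩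
    have hmono : ∀ {x : ℝ} {q : ℕ}, min (δ / 2) ε ≤ x → n ≤ q →
        min (δ / 2) ε * lam ^ n ≤ x * lam ^ q := fun hx hq =>
      mul_le_mul hx (pow_le_pow_right₀ h.one_lt.le hq) (pow_pos h.pos n).le
        ((lt_min (half_pos hδ) hε).le.trans hx)
    rcases B.eq_empty_or_nonempty with rfl | hBne
    · left; simp
    obtain ⟨j, hj, hmin⟩ := B.exists_min_image k hBne
    rcases diam_le_or_exists_gap B k G hG0 hj hmin with hd | ⟨T, hT, ⟨l, hl, hlT⟩, hjT⟩
    · have hBm : B.card * G ≤ m * G :=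
        Nat.mul_le_mul_right _ (by simpa using Finset.card_le_univ B)
      refine (hw B s k (k j) (hn.trans (hk j hj)) fun i hi =>
        ⟨hmin i hi, (hd i hi).trans (by omega)⟩).imp_right fun hle => le_trans ?_ hle
      exact hmono (min_le_right _ _) (hk j hj)
    · have hsplit := Finset.sum_filter_add_sum_filter_not B (fun i => T ≤ k i)
        (fun i => (s i : ℤ) * (a (k i) : ℤ))
      have hcU : (B.filter fun i => T ≤ k i).card ≤ p := by
        have : (B.filter fun i => T ≤ k i).card < B.card := Finset.card_lt_card
          (Finset.filter_ssubset.2 ⟨j, hj, by omega⟩)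
        omega
      have hcL : (B.filter fun i => ¬ T ≤ k i).card ≤ p := by
        have : (B.filter fun i => ¬ T ≤ k i).card < B.card := Finset.card_lt_card
          (Finset.filter_ssubset.2 ⟨l, hl, by omega⟩)
        omega
      have hnT : n ≤ T := (hk j hj).trans (by omega)
      rcases ih (B.filter fun i => T ≤ k i) s k T hcU (hn.trans hnT)
        (fun i hi => (Finset.mem_filter.1 hi).2) with hU | hU
      · rw [← hsplit, hU, zero_add]
        refine (ih (B.filter fun i => ¬ T ≤ k i) s k n hcL hn
          fun i hi => hk i (Finset.mem_filter.1 hi).1).imp_right fun hle => le_trans ?_ hle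
        exact hmono ((min_le_left _ _).trans (by linarith)) le_rfl
      · right
        have hL := h.abs_sum_le hC0 hC (B.filter fun i => ¬ T ≤ k i) s k (T - G) (by
          intro i hi
          obtain ⟨hi, hi'⟩ := Finset.mem_filter.1 hi
          have := hT i hi
          omega)
        have hgap := hG (T - G) T (by omega)
        rw [mul_assoc] at hgap
        rw [← hsplit, Int.cast_add]
        have htri := abs_sub_abs_le_abs_add
          ((∑ i ∈ B.filter fun i => T ≤ k i, (s i : ℤ) * (a (k i) : ℤ) : ℤ) : ℝ)
          ((∑ i ∈ B.filter fun i => ¬ T ≤ k i, (s i : ℤ) * (a (k i) : ℤ) : ℤ) : ℝ)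
        have := hmono (min_le_left _ _) hnT
        linarith

/-- If the indices of a vanishing signed sum have a large gap, then the part of the sum above
the gap vanishes. -/
theorem exists_gap_forall_sum_eq_zero (h : DominantGrowth a lam c) (m : ℕ) :
    ∃ G : ℕ, 0 < G ∧ ∀ (B : Finset (Fin m)) (s : Fin m → ℤˣ) (k : Fin m → ℕ) (T : ℕ), 1 ≤ T →
      (∀ i ∈ B, T ≤ k i ∨ k i + G ≤ T) → ∑ i ∈ B, (s i : ℤ) * (a (k i) : ℤ) = 0 →
      ∑ i ∈ B with T ≤ k i, (s i : ℤ) * (a (k i) : ℤ) = 0 := by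
  obtain ⟨C, hC0, hC⟩ := h.exists_le
  obtain ⟨δ, hδ, hlow⟩ := h.exists_lower_bound m
  obtain ⟨G, hG0, hG⟩ := h.exists_gap_size hδ (m * C)
  refine ⟨G, hG0, fun B s k T hT1 hT h0 => ?_⟩
  have hsplit := Finset.sum_filter_add_sum_filter_not B (fun i => T ≤ k i)
    (fun i => (s i : ℤ) * (a (k i) : ℤ))
  rcases hlow (B.filter fun i => T ≤ k i) s k T hT1
    (fun i hi => (Finset.mem_filter.1 hi).2) with hU | hU
  · exact hU
  by_cases hTG : G ≤ T
  · exfalso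
    have hL := h.abs_sum_le hC0 hC (B.filter fun i => ¬ T ≤ k i) s k (T - G) (by
      intro i hi
      obtain ⟨hi, hi'⟩ := Finset.mem_filter.1 hi
      have := hT i hi
      omega)
    have hgap := hG (T - G) T (by omega)
    rw [h0] at hsplit
    rw [eq_neg_of_add_eq_zero_left hsplit, Int.cast_neg, abs_neg] at hU
    rw [mul_assoc] at hgap
    linarith
  -- For `T < G` no index satisfies `k i + G ≤ T`, so the part above the gap is the whole sum.
  · rw [Finset.filter_true_of_mem, h0]
    intro i hi
    have := hT i hi
    omega

end DominantGrowth

/-! ### Cumulants of the trigonometric sum as sums of joint cumulants -/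

instance isProbabilityMeasure_uniform01 : IsProbabilityMeasure uniform01 :=
  ⟨by simp [uniform01]⟩

theorem Continuous.integrable_uniform01 {E : Type*} [NormedAddCommGroup E] {f : ℝ → E}
    (hf : Continuous f) : Integrable f uniform01 :=
  hf.continuousOn.integrableOn_compact isCompact_Icc

/-- The recursion between moments and cumulants. -/
theorem moment_succ_eq_sum_cumulant {Ω : Type*} [MeasurableSpace Ω] {μ : Measure Ω}
    [IsProbabilityMeasure μ] {X : Ω → ℝ} (hX : ∀ t, Integrable (fun ω => Real.exp (t * X ω)) μ)
    (p : ℕ) :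
    ∫ ω, X ω ^ (p + 1) ∂μ = ∑ i ∈ Finset.range (p + 1),
      p.choose i • (cumulant (i + 1) X μ * ∫ ω, X ω ^ (p - i) ∂μ) := by
  have hset : interior (integrableExpSet X μ) = Set.univ := by
    rw [interior_eq_univ, Set.eq_univ_iff_forall]
    exact hX
  have hmom : ∀ q, ∫ ω, X ω ^ q ∂μ = iteratedDeriv q (mgf X μ) 0 := fun q => by
    rw [iteratedDeriv_mgf_zero (by simp [hset])]
    rfl
  have hM : ∀ t, AnalyticAt ℝ (mgf X μ) t := fun t => analyticAt_mgf (by simp [hset])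
  have hK : ∀ t, AnalyticAt ℝ (cgf X μ) t := fun t => analyticAt_cgf (by simp [hset])
  -- The recursion is Leibniz's rule applied to `M' = K' * M`, where `K = log M`.
  have hd : deriv (mgf X μ) = deriv (cgf X μ) * mgf X μ := by
    ext t
    have hpos := mgf_pos (hX t)
    change _ = deriv (fun x => Real.log (mgf X μ x)) t * _
    rw [deriv.log (hM t).differentiableAt hpos.ne']
    field_simp
  rw [hmom, iteratedDeriv_succ', hd, iteratedDeriv_mul (hK 0).deriv.contDiffAt
    (hM 0).contDiffAt]
  refine Finset.sum_congr rfl fun i _ => ?_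
  rw [cumulant, iteratedDeriv_succ', hmom, nsmul_eq_mul, mul_assoc]

/-- The indicator function of the vanishing of a subsum. -/
def zeroSumIndicator {ι : Type*} (u : ι → ℤ) (B : Finset ι) : ℤ :=
  if ∑ i ∈ B, u i = 0 then 1 else 0

/-- The signed terms of `a` with sign and index prescribed by `v`. -/
def signedTerms {ι : Type*} (a : ℕ → ℕ) (v : ι → ℕ × ℤˣ) (i : ι) : ℤ :=
  ((v i).2 : ℤ) * (a (v i).1 : ℤ)

/-- The indices of the exponentials in `2 * trigSum a n`. -/
def signedIndices (n : ℕ) : Finset (ℕ × ℤˣ) := Finset.Icc 1 n ×ˢ Finset.univ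

theorem card_signedIndices (n : ℕ) : (signedIndices n).card = 2 * n := by
  simp [signedIndices, mul_comm]

theorem zeroSumIndicator_empty {ι : Type*} (u : ι → ℤ) : zeroSumIndicator u ∅ = 1 := by
  simp [zeroSumIndicator]

theorem zeroSumIndicator_congr {ι : Type*} {u w : ι → ℤ} {B : Finset ι}
    (h : ∀ i ∈ B, u i = w i) : zeroSumIndicator u B = zeroSumIndicator w B := by
  rw [zeroSumIndicator, zeroSumIndicator, Finset.sum_congr rfl h]

theorem continuous_trigSum (a : ℕ → ℕ) (n : ℕ) : Continuous (trigSum a n) := by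
  unfold trigSum
  fun_prop

theorem integral_cexp_uniform01 (N : ℤ) :
    ∫ ω, Complex.exp (2 * Real.pi * Complex.I * N * (ω : ℂ)) ∂uniform01
      = if N = 0 then 1 else 0 := by
  split_ifs with h
  · simp [h]
  · have hc : 2 * Real.pi * Complex.I * (N : ℂ) ≠ 0 := by
      simp [h, Real.pi_ne_zero]
    rw [uniform01, integral_Icc_eq_integral_Ioc,
      ← intervalIntegral.integral_of_le zero_le_one, integral_exp_mul_complex hc]
    have : 2 * Real.pi * Complex.I * (N : ℂ) * ((1 : ℝ) : ℂ) = N * (2 * Real.pi * Complex.I) := by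
      push_cast; ring
    rw [this, Complex.exp_int_mul_two_pi_mul_I]
    simp

theorem sum_signedIndices_cexp (a : ℕ → ℕ) (n : ℕ) (ω : ℝ) :
    ∑ x ∈ signedIndices n,
      Complex.exp (2 * Real.pi * Complex.I * (((x.2 : ℤ) * (a x.1 : ℤ) : ℤ) : ℂ) * (ω : ℂ))
      = ((2 * trigSum a n ω : ℝ) : ℂ) := by
  rw [signedIndices, Finset.sum_product, trigSum, Finset.mul_sum, Complex.ofReal_sum]
  refine Finset.sum_congr rfl fun k _ => ?_
  rw [show (Finset.univ : Finset ℤˣ) = {1, -1} from rfl, Finset.sum_pair (by decide)]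
  push_cast
  rw [Complex.two_cos]
  congr 2 <;> ring

/-- By orthogonality each indicator is the integral of a product of exponentials. Summing over
tuples factors the integrand: a coordinate in `B` contributes `2 * trigSum a n`, a free one the
number `2 * n` of signed indices. -/
theorem sum_zeroSumIndicator {ι : Type*} [Fintype ι] [DecidableEq ι] (a : ℕ → ℕ) (n : ℕ)
    (B : Finset ι) :
    ∑ v ∈ Fintype.piFinset fun _ : ι => signedIndices n,
      (zeroSumIndicator (signedTerms a v) B : ℝ)
      = 2 ^ B.card * (2 * n : ℝ) ^ (Fintype.card ι - B.card)
        * ∫ ω, trigSum a n ω ^ B.card ∂uniform01 := by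
  have h1 : ∀ v : ι → ℕ × ℤˣ, (zeroSumIndicator (signedTerms a v) B : ℂ)
      = ∫ ω, ∏ i, (if i ∈ B then Complex.exp (2 * Real.pi * Complex.I *
          ((((v i).2 : ℤ) * (a (v i).1 : ℤ) : ℤ) : ℂ) * ((ω : ℝ) : ℂ)) else 1) ∂uniform01 := by
    intro v
    have : (zeroSumIndicator (signedTerms a v) B : ℂ)
        = if ∑ i ∈ B, signedTerms a v i = 0 then 1 else 0 := by
      unfold zeroSumIndicator
      split_ifs <;> simp
    rw [this, ← integral_cexp_uniform01]
    congr 1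
    ext ω
    rw [Finset.prod_ite_mem, Finset.univ_inter, ← Complex.exp_sum, ← Finset.sum_mul,
      ← Finset.mul_sum, Int.cast_sum]
    rfl
  have h2 : ∀ ω : ℝ, ∑ v ∈ Fintype.piFinset fun _ : ι => signedIndices n,
      ∏ i, (if i ∈ B then Complex.exp (2 * Real.pi * Complex.I *
          ((((v i).2 : ℤ) * (a (v i).1 : ℤ) : ℤ) : ℂ) * (ω : ℂ)) else 1)
      = ((2 ^ B.card * (2 * n : ℝ) ^ (Fintype.card ι - B.card)
        * trigSum a n ω ^ B.card : ℝ) : ℂ) := by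
    intro ω
    rw [← Finset.prod_univ_sum (fun _ : ι => signedIndices n) fun i x =>
      (if i ∈ B then Complex.exp (2 * Real.pi * Complex.I *
          (((x.2 : ℤ) * (a x.1 : ℤ) : ℤ) : ℂ) * (ω : ℂ)) else 1)]
    have : ∀ i : ι, ∑ x ∈ signedIndices n, (if i ∈ B then Complex.exp (2 * Real.pi * Complex.I *
          (((x.2 : ℤ) * (a x.1 : ℤ) : ℤ) : ℂ) * (ω : ℂ)) else 1)
        = if i ∈ B then ((2 * trigSum a n ω : ℝ) : ℂ) else ((2 * n : ℝ) : ℂ) := by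
      intro i
      split_ifs
      · exact sum_signedIndices_cexp a n ω
      · simp [card_signedIndices]
    rw [Finset.prod_congr rfl fun i _ => this i, Finset.prod_ite, Finset.prod_const,
      Finset.prod_const, Finset.filter_mem_eq_inter, Finset.univ_inter,
      Finset.filter_not, Finset.filter_mem_eq_inter, Finset.univ_inter,
      ← Finset.compl_eq_univ_sdiff, Finset.card_compl]
    push_cast
    ring
  have h3 : ((∑ v ∈ Fintype.piFinset fun _ : ι => signedIndices n,
      (zeroSumIndicator (signedTerms a v) B : ℝ) : ℝ) : ℂ)
      = ((2 ^ B.card * (2 * n : ℝ) ^ (Fintype.card ι - B.card)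
        * ∫ ω, trigSum a n ω ^ B.card ∂uniform01 : ℝ) : ℂ) := by
    rw [← integral_const_mul, ← integral_complex_ofReal]
    simp_rw [← h2]
    rw [integral_finsetSum]
    · rw [Complex.ofReal_sum]
      exact Finset.sum_congr rfl fun v _ => (Complex.ofReal_intCast _).trans (h1 v)
    · intro v _
      refine Continuous.integrable_uniform01 (continuous_finsetProd _ fun i _ => ?_)
      split_ifs <;> fun_prop
  exact_mod_cast h3

/-- The cumulants of `trigSum a n` as sums of joint cumulants. -/
theorem sum_jointCumulant_eq_cumulant (a : ℕ → ℕ) (n : ℕ) (hn : 1 ≤ n) (m : ℕ) (hm : 1 ≤ m) :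
    ((∑ v ∈ Fintype.piFinset fun _ : Fin m => signedIndices n,
      jointCumulant (zeroSumIndicator (signedTerms a v)) Finset.univ : ℤ) : ℝ)
      = 2 ^ m * cumulant m (trigSum a n) uniform01 := by
  have hn0 : (n : ℝ) ≠ 0 := by positivity
  have hN : (2 * n : ℝ) ≠ 0 := by positivity
  set N : ℝ := (2 * n : ℝ) ^ m with hNdef
  have hNne : N ≠ 0 := pow_ne_zero _ hN
  have hcard : ((signedIndices n).card : ℝ) ^ Fintype.card (Fin m) = N := by
    simp [card_signedIndices, hNdef]
  -- Averages over all `(2 * n) ^ m` tuples obey the one-variable recursion: the mean moment of `B`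
  -- is the `B.card`-th moment of `2 * trigSum a n / (2 * n)`, whence the ratio `1 / n`.
  have key := averaged_cumulant (ι := Fin m) (M := fun p => ∫ ω, trigSum a n ω ^ p ∂uniform01)
    (K := fun p => cumulant p (trigSum a n) uniform01) (by simp) ((n : ℝ)⁻¹)
    (fun p => moment_succ_eq_sum_cumulant (fun t => Continuous.integrable_uniform01
      (by have := continuous_trigSum a n; fun_prop)) p)
    (μ := fun B => N⁻¹ * ∑ v ∈ Fintype.piFinset fun _ : Fin m => signedIndices n,
      (zeroSumIndicator (signedTerms a v) B : ℝ))
    (κ := fun B => N⁻¹ * ∑ v ∈ Fintype.piFinset fun _ : Fin m => signedIndices n,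
      (jointCumulant (zeroSumIndicator (signedTerms a v)) B : ℝ)) ?_ ?_ Finset.univ
      ⟨⟨0, hm⟩, Finset.mem_univ _⟩
  · simp only [Finset.card_univ, Fintype.card_fin] at key
    push_cast
    rw [inv_mul_eq_iff_eq_mul₀ hNne] at key
    rw [key, hNdef, mul_pow, inv_pow]
    field_simp
  · intro B
    have hB : B.card ≤ m := by simpa using Finset.card_le_univ B
    simp only [sum_zeroSumIndicator, Fintype.card_fin]
    have hsplit : N = (2 * n : ℝ) ^ (m - B.card) * (2 ^ B.card * (n : ℝ) ^ B.card) := by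
      rw [← mul_pow, ← pow_add, Nat.sub_add_cancel hB]
    rw [inv_mul_eq_iff_eq_mul₀ hNne, hsplit, inv_pow]
    field_simp
  · intro B h
    set b := B.min' h
    have hprod : ∀ C ∈ (B.erase b).powerset,
        N⁻¹ * (∑ v ∈ Fintype.piFinset fun _ : Fin m => signedIndices n,
          (jointCumulant (zeroSumIndicator (signedTerms a v)) (insert b C) : ℝ))
        * (N⁻¹ * ∑ v ∈ Fintype.piFinset fun _ : Fin m => signedIndices n,
          (zeroSumIndicator (signedTerms a v) (B.erase b \ C) : ℝ))
        = N⁻¹ * ∑ v ∈ Fintype.piFinset fun _ : Fin m => signedIndices n,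
          (jointCumulant (zeroSumIndicator (signedTerms a v)) (insert b C) : ℝ)
            * (zeroSumIndicator (signedTerms a v) (B.erase b \ C) : ℝ) := by
      -- The two factors depend on disjoint sets of coordinates, so the product of their averages is
      -- the average of their product.
      intro C hC
      have := sum_piFinset_mul_of_disjoint (signedIndices n) (insert b C)
        (fun v : Fin m → ℕ × ℤˣ =>
          (jointCumulant (zeroSumIndicator (signedTerms a v)) (insert b C) : ℝ))
        (fun v => (zeroSumIndicator (signedTerms a v) (B.erase b \ C) : ℝ))
        (fun v w hvw => by
          congr 1
          exact jointCumulant_congr _ fun D hD => zeroSumIndicator_congr fun i hi => by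
            rw [signedTerms, signedTerms, hvw i (hD hi)])
        (fun v w hvw => by
          congr 1
          refine zeroSumIndicator_congr fun i hi => ?_
          rw [signedTerms, signedTerms, hvw i]
          simp only [Finset.mem_sdiff, Finset.mem_erase] at hi
          simp only [Finset.mem_insert]
          tauto)
      rw [hcard] at this
      rw [mul_mul_mul_comm, this]
      field_simp
    rw [Finset.sum_congr rfl hprod, ← Finset.mul_sum, Finset.sum_comm]
    congr 1
    refine Finset.sum_congr rfl fun v _ => ?_
    have := sum_jointCumulant (zeroSumIndicator_empty (signedTerms a v)) h
    exact_mod_cast this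

/-! ### Locality of the joint cumulants -/

namespace DominantGrowth

open Filter Topology

variable {a : ℕ → ℕ} {lam c : ℝ}

/-- Joint cumulants of exponentials vanish unless the indices are close to each other. -/
theorem exists_diam_le_of_jointCumulant_ne_zero (h : DominantGrowth a lam c) (m : ℕ) :
    ∃ D : ℕ, ∀ v : Fin m → ℕ × ℤˣ,
      jointCumulant (zeroSumIndicator (signedTerms a v)) Finset.univ ≠ 0 →
      ∀ i j, (v i).1 ≤ (v j).1 + D := by
  obtain ⟨G, hG0, hG⟩ := h.exists_gap_forall_sum_eq_zero m
  refine ⟨m * G, fun v hv i j => ?_⟩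
  obtain ⟨l, hl, hmin⟩ := Finset.univ.exists_min_image (fun i => (v i).1) ⟨i, Finset.mem_univ i⟩
  rcases diam_le_or_exists_gap Finset.univ (fun i => (v i).1) G hG0 hl hmin with
    hd | ⟨T, hT, hTi, hlT⟩
  · have h1 := hd i (Finset.mem_univ i)
    have h2 := hmin j (Finset.mem_univ j)
    simp only [Finset.card_univ, Fintype.card_fin] at h1
    omega
  · refine absurd (jointCumulant_eq_zero (zeroSumIndicator_empty _) (fun i => T ≤ (v i).1)
      (fun B => ?_) Finset.univ hTi ⟨l, hl, by omega⟩) hv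
    have hsplit := Finset.sum_filter_add_sum_filter_not B (fun i => T ≤ (v i).1) (signedTerms a v)
    -- A vanishing sum has vanishing upper part, hence vanishing lower part, so the indicator of `B`
    -- is the product of those of its two parts.
    have hz : ∑ i ∈ B, signedTerms a v i = 0 →
        ∑ i ∈ B with T ≤ (v i).1, signedTerms a v i = 0 :=
      hG B (fun i => (v i).2) (fun i => (v i).1) T (by omega)
        fun i _ => hT i (Finset.mem_univ i)
    unfold zeroSumIndicator
    by_cases h0 : ∑ i ∈ B, signedTerms a v i = 0
    · have h1 := hz h0
      rw [h0, h1, zero_add] at hsplit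
      rw [if_pos h0, if_pos h1, if_pos hsplit, one_mul]
    · rw [if_neg h0]
      by_cases h1 : ∑ i ∈ B with T ≤ (v i).1, signedTerms a v i = 0
      · rw [h1, zero_add] at hsplit
        rw [hsplit, if_neg h0, mul_zero]
      · rw [if_neg h1, zero_mul]

end DominantGrowth

/-! ### Translation invariance and linear growth -/

/-- The joint cumulants of all tuples of exponentials in `2 * trigSum a n`. -/
def jointCumulantSum (a : ℕ → ℕ) (m n : ℕ) : ℤ :=
  ∑ v ∈ Fintype.piFinset fun _ : Fin m => signedIndices n,
    jointCumulant (zeroSumIndicator (signedTerms a v)) Finset.univ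

/-- The tuples of offsets in `[0, D]`, with signs, for which the offset `0` occurs. -/
def signedOffsets (m D : ℕ) : Finset (Fin m → ℕ × ℤˣ) :=
  (Fintype.piFinset fun _ : Fin m => Finset.range (D + 1) ×ˢ Finset.univ).filter
    fun x => ∃ i, (x i).1 = 0

/-- The tuple of indices obtained by subtracting the offsets `x` from `n`. -/
def indicesOfOffsets {m : ℕ} (x : Fin m → ℕ × ℤˣ) (n : ℕ) : Fin m → ℕ × ℤˣ :=
  fun i => (n - (x i).1, (x i).2)

/-- The new tuples are those in which the index `n + 1` occurs, and locality confines the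
contributing ones to `[n + 1 - D, n + 1]`. The assumption `D ≤ n` keeps these indices positive, so
subtraction from `n + 1` is a bijection with the offsets. -/
theorem jointCumulantSum_succ {a : ℕ → ℕ} {m D : ℕ}
    (hD : ∀ v : Fin m → ℕ × ℤˣ,
      jointCumulant (zeroSumIndicator (signedTerms a v)) Finset.univ ≠ 0 →
      ∀ i j, (v i).1 ≤ (v j).1 + D) {n : ℕ} (hn : D ≤ n) :
    jointCumulantSum a m (n + 1) = jointCumulantSum a m n + ∑ x ∈ signedOffsets m D,
      jointCumulant (zeroSumIndicator (signedTerms a (indicesOfOffsets x (n + 1))))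
        Finset.univ := by
  have hmem : ∀ (q : ℕ) (v : Fin m → ℕ × ℤˣ),
      (v ∈ Fintype.piFinset fun _ : Fin m => signedIndices q) ↔
        ∀ i, 1 ≤ (v i).1 ∧ (v i).1 ≤ q := by
    simp only [signedIndices, Fintype.mem_piFinset, Finset.mem_product, Finset.mem_Icc,
      Finset.mem_univ, and_true, implies_true]
  have hmemO : ∀ x : Fin m → ℕ × ℤˣ,
      x ∈ signedOffsets m D ↔ (∀ i, (x i).1 ≤ D) ∧ ∃ i, (x i).1 = 0 := by
    simp only [signedOffsets, Finset.mem_filter, Fintype.mem_piFinset, Finset.mem_product,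
      Finset.mem_range, Finset.mem_univ, and_true, Nat.lt_succ_iff, implies_true]
  rw [jointCumulantSum, ← Finset.sum_filter_not_add_sum_filter _ fun v => ∃ i, (v i).1 = n + 1]
  congr 1
  · rw [jointCumulantSum]
    refine Finset.sum_congr ?_ fun _ _ => rfl
    ext v
    simp only [Finset.mem_filter, hmem, not_exists]
    constructor
    · rintro ⟨h1, h2⟩ i
      have := h1 i
      have := h2 i
      omega
    · intro h
      exact ⟨fun i => ⟨(h i).1, (h i).2.trans (by omega)⟩, fun i hi => by have := h i; omega⟩
  · rw [← Finset.sum_filter_of_ne (p := fun v => ∀ i, n + 1 ≤ (v i).1 + D)]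
    · refine Finset.sum_nbij' (fun v => indicesOfOffsets v (n + 1))
        (fun x => indicesOfOffsets x (n + 1)) ?_ ?_ ?_ ?_ ?_
      · intro v hv
        simp only [Finset.mem_filter, hmem] at hv
        obtain ⟨⟨h1, j, hj⟩, h2⟩ := hv
        rw [hmemO]
        exact ⟨fun i => by have := h2 i; simp only [indicesOfOffsets]; omega,
          j, by simp [indicesOfOffsets, hj]⟩
      · intro x hx
        rw [hmemO] at hx
        obtain ⟨h1, j, hj⟩ := hx
        simp only [Finset.mem_filter, hmem, indicesOfOffsets]
        exact ⟨⟨fun i => by have := h1 i; omega, j, by omega⟩, fun i => by have := h1 i; omega⟩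
      · intro v hv
        simp only [Finset.mem_filter, hmem] at hv
        ext i
        · have := hv.1.1 i
          simp only [indicesOfOffsets]
          omega
        · rfl
      · intro x hx
        rw [hmemO] at hx
        ext i
        · have := hx.1 i
          simp only [indicesOfOffsets]
          omega
        · rfl
      · intro v hv
        simp only [Finset.mem_filter, hmem] at hv
        congr 3
        ext i
        · have := hv.1.1 i
          simp only [indicesOfOffsets]
          omega
        · rfl
    · intro v hv hne i
      obtain ⟨_, j, hj⟩ := Finset.mem_filter.1 hv
      rw [← hj]
      exact hD v hne j i

namespace DominantGrowth

open Filter Topology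

variable {a : ℕ → ℕ} {lam c : ℝ}

/-- Joint cumulants of exponentials are eventually invariant under translation of the indices. -/
theorem eventually_jointCumulant_eq (h : DominantGrowth a lam c) {m : ℕ} (x : Fin m → ℕ × ℤˣ) :
    ∃ z : ℤ, ∀ᶠ n in atTop,
      jointCumulant (zeroSumIndicator (signedTerms a (indicesOfOffsets x n))) Finset.univ = z := by
  obtain ⟨D, hD⟩ : ∃ D, ∀ i, (x i).1 ≤ D :=
    ⟨Finset.univ.sup fun i => (x i).1,
      fun i => Finset.le_sup (f := fun i => (x i).1) (Finset.mem_univ i)⟩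
  classical
  -- The limit replaces vanishing of the signed sum by the relation in `lam`. Measuring from `n - D`
  -- turns the offsets into nonnegative exponents `D - (x i).1`.
  refine ⟨jointCumulant (fun B => if ∑ i ∈ B, (((x i).2 : ℤ) : ℝ) * lam ^ (D - (x i).1) = 0
    then 1 else 0) Finset.univ, ?_⟩
  have key := (tendsto_sub_atTop_nat D).eventually (eventually_all.2 fun B : Finset (Fin m) =>
    h.eventually_sum_eq_zero_iff B (fun i => ((x i).2 : ℤ)) fun i => D - (x i).1)
  filter_upwards [key, eventually_ge_atTop D] with n hn hDn
  refine jointCumulant_congr _ fun B _ => ?_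
  have e : ∑ i ∈ B, signedTerms a (indicesOfOffsets x n) i
      = ∑ i ∈ B, ((x i).2 : ℤ) * (a (n - D + (D - (x i).1)) : ℤ) := by
    refine Finset.sum_congr rfl fun i _ => ?_
    have := hD i
    rw [show n - D + (D - (x i).1) = n - (x i).1 by omega]
    rfl
  rw [zeroSumIndicator, e]
  exact if_congr (hn B) rfl rfl

theorem exists_jointCumulantSum_eq (h : DominantGrowth a lam c) (m : ℕ) :
    ∃ w b : ℤ, ∃ N : ℕ, ∀ n, N ≤ n → jointCumulantSum a m n = w * n + b := by
  obtain ⟨D, hD⟩ := h.exists_diam_le_of_jointCumulant_ne_zero m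
  choose z hz using fun x : Fin m → ℕ × ℤˣ => h.eventually_jointCumulant_eq x
  obtain ⟨N, hN⟩ := eventually_atTop.1
    ((Finset.eventually_all (signedOffsets m D)).2 fun x _ => hz x)
  set w := ∑ x ∈ signedOffsets m D, z x
  refine ⟨w, jointCumulantSum a m (max N D) - w * (max N D : ℕ), max N D, fun n hn => ?_⟩
  induction n, hn using Nat.le_induction with
  | base => ring
  | succ n hn ih =>
    rw [jointCumulantSum_succ hD ((le_max_right _ _).trans hn), ih,
      Finset.sum_congr rfl (hN (n + 1) (by omega))]
    push_cast
    ring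

end DominantGrowth

/-! ### Conjugate roots and the main theorem -/

/-- An integral polynomial which vanishes at one root of an irreducible polynomial vanishes at
all its roots. -/
theorem aeval_eq_zero_of_irreducible {P Q : Polynomial ℤ}
    (hP : Irreducible (P.map (Int.castRingHom ℚ))) {x y : ℂ} (hx : Polynomial.aeval x P = 0)
    (hy : Polynomial.aeval y P = 0) (hQ : Polynomial.aeval x Q = 0) :
    Polynomial.aeval y Q = 0 := by
  have hmap : ∀ (R : Polynomial ℤ) (t : ℂ),
      Polynomial.aeval t (R.map (Int.castRingHom ℚ)) = Polynomial.aeval t R := fun R t =>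
    Polynomial.aeval_map_algebraMap ℚ t R
  rcases (EuclideanDomain.dvd_or_coprime _ (Q.map (Int.castRingHom ℚ)) hP).symm with hc | ⟨R, hR⟩
  · obtain ⟨u, v, huv⟩ := hc
    have := congrArg (Polynomial.aeval x) huv
    simp [hmap, hx, hQ] at this
  · rw [← hmap, hR, map_mul, hmap, hy, zero_mul]

-- Dividing by the power of the dominant root leaves its coefficient as the limit, real because the
-- sequence is. An integral relation between powers of that root passes to every `lam j` by
-- irreducibility; weighting by `c j * lam j ^ n` and summing over `j` gives the relation for the
-- shifts of `a`.
open Filter Topology in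
theorem dominantGrowth_of_dominantRoot {d : ℕ} (hd : 0 < d) {c lam : Fin d → ℂ}
    (hroots : AreRootsOfIrreducible lam) (hdom : DominantRoot hd c lam) {a : ℕ → ℕ}
    (ha : ∀ k, 1 ≤ k → (a k : ℂ) = ∑ j, c j * lam j ^ k) :
    ∃ r : ℝ, DominantGrowth a (lam ⟨0, hd⟩).re r := by
  obtain ⟨P, -, hP, hPr⟩ := hroots
  obtain ⟨him, h1, hlt, hc⟩ := hdom
  set l := (lam ⟨0, hd⟩).re with hl
  have hl0 : lam ⟨0, hd⟩ = (l : ℂ) := Complex.ext (by simp [hl]) (by simp [him])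
  have hlpos : 0 < l := one_pos.trans h1
  have hlim : Tendsto (fun n => (((a n : ℝ) / l ^ n : ℝ) : ℂ)) atTop (𝓝 (c ⟨0, hd⟩)) := by
    have hsum : Tendsto (fun n => ∑ j, c j * (lam j / l) ^ n) atTop
        (𝓝 (∑ j, if j = ⟨0, hd⟩ then c j else 0)) := by
      refine tendsto_finsetSum _ fun j _ => ?_
      split_ifs with hj
      · subst hj
        have hne : (l : ℂ) ≠ 0 := by exact_mod_cast hlpos.ne'
        simp [hl0, div_self hne]
      · rw [← mul_zero (c j)]
        refine (tendsto_pow_atTop_nhds_zero_of_norm_lt_one ?_).const_mul _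
        rw [norm_div, Complex.norm_real, Real.norm_of_nonneg hlpos.le, div_lt_one hlpos]
        exact hlt j hj
    rw [Finset.sum_ite_eq' Finset.univ, if_pos (Finset.mem_univ _)] at hsum
    refine hsum.congr' ?_
    filter_upwards [eventually_ge_atTop 1] with n hn
    push_cast
    rw [ha n hn, Finset.sum_div]
    exact Finset.sum_congr rfl fun j _ => by rw [div_pow, mul_div_assoc]
  have hre := (Complex.continuous_re.tendsto _).comp hlim
  have him' := (Complex.continuous_im.tendsto _).comp hlim
  have him0 : (c ⟨0, hd⟩).im = 0 := by
    refine tendsto_nhds_unique him' ?_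
    simp only [Function.comp_def, Complex.ofReal_im]
    exact tendsto_const_nhds
  refine ⟨(c ⟨0, hd⟩).re, h1, fun h0 => hc (Complex.ext h0 him0), ?_, ?_⟩
  · simpa only [Function.comp_def, Complex.ofReal_re] using hre
  · intro m B s e h0 n hn
    set Q : Polynomial ℤ := ∑ i ∈ B, Polynomial.C (s i) * Polynomial.X ^ e i with hQ
    have hQe : ∀ t : ℂ, Polynomial.aeval t Q = ∑ i ∈ B, (s i : ℂ) * t ^ e i := by
      intro t
      simp [hQ, map_sum]
    have hQ0 : Polynomial.aeval (lam ⟨0, hd⟩) Q = 0 := by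
      rw [hQe, hl0]
      exact_mod_cast h0
    have hQj : ∀ j, ∑ i ∈ B, (s i : ℂ) * lam j ^ e i = 0 := fun j => by
      rw [← hQe]
      exact aeval_eq_zero_of_irreducible hP (hPr _) (hPr j) hQ0
    have : ((∑ i ∈ B, s i * (a (n + e i) : ℤ) : ℤ) : ℂ) = 0 := by
      push_cast
      calc ∑ i ∈ B, (s i : ℂ) * (a (n + e i) : ℂ)
          = ∑ i ∈ B, ∑ j, c j * lam j ^ n * ((s i : ℂ) * lam j ^ e i) := by
            refine Finset.sum_congr rfl fun i _ => ?_
            rw [ha _ (by omega), Finset.mul_sum]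
            exact Finset.sum_congr rfl fun j _ => by rw [pow_add]; ring
        _ = ∑ j, c j * lam j ^ n * ∑ i ∈ B, (s i : ℂ) * lam j ^ e i := by
            rw [Finset.sum_comm]
            simp_rw [Finset.mul_sum]
        _ = 0 := by simp [hQj]
    exact_mod_cast this

theorem theoremC {d : ℕ} (hd : 0 < d) (c lam : Fin d → ℂ)
    (hroots : AreRootsOfIrreducible lam) (hdom : DominantRoot hd c lam) :
    ∃ w b : ℕ → ℤ,
      ∀ a : ℕ → ℕ, (∀ k, 1 ≤ k → 0 < a k ∧ (a k : ℂ) = ∑ j, c j * lam j ^ k) →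
        ∀ m, 1 ≤ m → ∃ n₁ : ℕ, ∀ n, n₁ < n →
          cumulant m (trigSum a n) uniform01 = ((w m : ℝ) * n + b m) / 2 ^ m := by
  -- The integers must precede `a`, but `c` and `lam` determine `a k` for all `k ≥ 1`, the only
  -- values that `trigSum` sees. Any one such sequence supplies them, and if there is none the claim
  -- is empty.
  by_cases hex : ∃ a : ℕ → ℕ, ∀ k, 1 ≤ k → (a k : ℂ) = ∑ j, c j * lam j ^ k
  · obtain ⟨a₀, ha₀⟩ := hex
    obtain ⟨r, hr⟩ := dominantGrowth_of_dominantRoot hd hroots hdom ha₀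
    choose w b N hN using fun m => hr.exists_jointCumulantSum_eq m
    refine ⟨w, b, fun a ha m hm => ⟨N m, fun n hn => ?_⟩⟩
    have haa : trigSum a n = trigSum a₀ n := by
      ext ω
      refine Finset.sum_congr rfl fun k hk => ?_
      have hk1 := (Finset.mem_Icc.1 hk).1
      have : a k = a₀ k := by
        exact_mod_cast (ha k hk1).2.trans (ha₀ k hk1).symm
      rw [this]
    have h1 := sum_jointCumulant_eq_cumulant a₀ n (by omega) m hm
    have h2 := hN m n hn.le
    rw [jointCumulantSum] at h2
    rw [h2] at h1
    rw [haa, eq_div_iff (by positivity), mul_comm, ← h1]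
    push_cast
    rfl
  · exact ⟨0, 0, fun a ha => absurd ⟨a, fun k hk => (ha k hk).2⟩ hex⟩
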